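/- Let $p\ge 5$ be a prime with $p\equiv 3\pmod 4$. Then $$\sum_{k=0}^{\frac{p-1}{2}}(-1)^k(4k+1)\left(\frac{\left(\frac12\right)_k}{k!}\right)^5\equiv -\frac{p^3}{16}\,\Gamma_p\!\left(\frac14\right)^4\pmod{p^4},$$ that is, the difference of the two sides lies in $p^4\mathbb{Z}_p$, where $\mathbb{Z}_p$ is the ring of $p$-adic integers. Here $(a)_0=1$ and $(a)_n=a(a+1)\cdots(a+n-1)$ for $n\ge 1$, and $\Gamma_p:\mathbb{Z}_p\to\mathbb{Z}_p$ is the $p$-adic Gamma function $$\Gamma_p(x)=\lim_{m\to x}(-1)^m\prod_{\substack{0<k<m\\ \gcd(k,p)=1}}k,$$ the limit being taken over non-negative integers $m$ tending $p$-adically to $x$. -/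

import Mathlib

/-- The integers `(-1)^m * ∏_{0 < k < m, gcd(k, p) = 1} k` that interpolate to the `p`-adic Gamma
function. -/
def padicGammaSeq (p m : ℕ) : ℤ :=
  (-1) ^ m * ∏ k ∈ Finset.Ioo 0 m with Nat.Coprime k p, (k : ℤ)

/-- The `p`-adic Gamma function (for odd `p`) on the `p`-adic integers: the limit of
`padicGammaSeq p m` as the non-negative integer `m` tends to `x` in the `p`-adic topology.
The limit exists, see `tendsto_padicGamma`. -/
noncomputable def padicGamma (p : ℕ) [Fact p.Prime] (x : ℤ_[p]) : ℤ_[p] :=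
  Filter.limUnder (Filter.comap (Nat.cast : ℕ → ℤ_[p]) (nhds x)) fun m : ℕ => (padicGammaSeq p m : ℤ_[p])

theorem padicGammaSeq_succ (p : ℕ) [Fact p.Prime] (m : ℕ) :
    padicGammaSeq p (m + 1) = - (padicGammaSeq p m * if Nat.Coprime m p then (m : ℤ) else 1) := by
  have hp := (Fact.out : p.Prime)
  unfold padicGammaSeq
  rcases Nat.eq_zero_or_pos m with rfl | hm
  · have h1 : Finset.Ioo 0 (0 + 1) = ∅ := by decide
    simp [h1, hp.ne_one]
  · have h : Finset.Ioo 0 (m + 1) = insert m (Finset.Ioo 0 m) := by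
      ext k; simp only [Finset.mem_Ioo, Finset.mem_insert]; omega
    rw [h, Finset.filter_insert]
    split_ifs with hc
    · rw [Finset.prod_insert (by simp)]; ring
    · ring

/-- Wilson's theorem modulo an odd prime power. -/
theorem prod_units_zmod_prime_pow (p : ℕ) [Fact p.Prime] (hp2 : p ≠ 2) (n : ℕ) [NeZero (p ^ n)] :
    ∏ u : (ZMod (p ^ n))ˣ, u = -1 := by
  classical
  have hp := (Fact.out : p.Prime)
  have key : ∀ u : (ZMod (p ^ n))ˣ, u * u = 1 → u = 1 ∨ u = -1 := by
    intro u hu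
    obtain ⟨a, ha⟩ := ZMod.intCast_surjective (u : ZMod (p ^ n))
    have h1 : ((a * a - 1 : ℤ) : ZMod (p ^ n)) = 0 := by
      push_cast; rw [ha, ← Units.val_mul, hu]; simp
    rw [ZMod.intCast_zmod_eq_zero_iff_dvd] at h1
    have h2 : ((p : ℤ) ^ n) ∣ (a - 1) * (a + 1) := by
      convert h1 using 1
      · push_cast; rfl
      · ring
    have hpZ : Prime (p : ℤ) := Nat.prime_iff_prime_int.mp hp
    by_cases hd : (p : ℤ) ∣ a - 1
    · have hnd : ¬ (p : ℤ) ∣ a + 1 := by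
        intro h
        have h3 : (p : ℤ) ∣ (2 : ℕ) := by
          have := dvd_sub h hd; ring_nf at this; exact_mod_cast this
        have h4 := (Nat.prime_dvd_prime_iff_eq hp Nat.prime_two).mp (Int.natCast_dvd_natCast.mp h3)
        exact hp2 h4
      have h5 := hpZ.pow_dvd_of_dvd_mul_right n hnd h2
      left
      have h6 : ((a - 1 : ℤ) : ZMod (p ^ n)) = 0 := by
        rw [ZMod.intCast_zmod_eq_zero_iff_dvd]; exact_mod_cast h5
      ext
      push_cast at h6
      rw [← ha, Units.val_one]; exact sub_eq_zero.mp h6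
    · have h5 := hpZ.pow_dvd_of_dvd_mul_left n hd h2
      right
      have h6 : ((a + 1 : ℤ) : ZMod (p ^ n)) = 0 := by
        rw [ZMod.intCast_zmod_eq_zero_iff_dvd]; exact_mod_cast h5
      ext
      push_cast at h6
      rw [← ha, Units.val_neg, Units.val_one]; exact eq_neg_of_add_eq_zero_left h6
  have hinv : ∏ u ∈ (Finset.univ.erase (-1) : Finset (ZMod (p ^ n))ˣ), u = 1 := by
    refine Finset.prod_involution (fun u _ => u⁻¹) (by simp) ?_ ?_ (by simp)
    · intro u hu hne heq
      have : u * u = 1 := by nth_rewrite 1 [← heq]; simp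
      rcases key u this with h | h
      · exact hne h
      · simp [h] at hu
    · intro u hu
      simp only [Finset.mem_erase, Finset.mem_univ, and_true] at hu ⊢
      intro h
      exact hu (by rw [← inv_inv u, h]; simp)
  rw [← Finset.mul_prod_erase Finset.univ (fun u => u) (Finset.mem_univ (-1)), hinv, mul_one]

theorem padicGammaSeq_prime_pow (p : ℕ) [Fact p.Prime] (hp2 : p ≠ 2) {n : ℕ} (hn : n ≠ 0) :
    (padicGammaSeq p (p ^ n) : ZMod (p ^ n)) = 1 := by
  classical
  have hp := (Fact.out : p.Prime)
  have : NeZero (p ^ n) := ⟨(pow_pos hp.pos n).ne'⟩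
  have hprod : ∏ k ∈ Finset.Ioo 0 (p ^ n) with Nat.Coprime k p, (k : ZMod (p ^ n)) =
      ∏ u : (ZMod (p ^ n))ˣ, (u : ZMod (p ^ n)) := by
    symm
    refine Finset.prod_bij (fun u _ => (u : ZMod (p ^ n)).val) ?_ ?_ ?_ ?_
    · intro u _
      have hc : Nat.Coprime (u : ZMod (p ^ n)).val p :=
        ((ZMod.val_coe_unit_coprime u).coprime_dvd_right (dvd_pow_self p hn))
      simp only [Finset.mem_filter, Finset.mem_Ioo]
      refine ⟨⟨Nat.pos_of_ne_zero ?_, ZMod.val_lt _⟩, hc⟩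
      intro h0
      rw [h0, Nat.coprime_zero_left] at hc
      exact hp.ne_one hc
    · intro u _ v _ h
      exact Units.ext (ZMod.val_injective _ h)
    · intro k hk
      simp only [Finset.mem_filter, Finset.mem_Ioo] at hk
      refine ⟨ZMod.unitOfCoprime k (hk.2.pow_right n), Finset.mem_univ _, ?_⟩
      rw [ZMod.coe_unitOfCoprime, ZMod.val_natCast, Nat.mod_eq_of_lt hk.1.2]
    · intro u _
      simp
  have hodd : Odd (p ^ n) := (hp.odd_of_ne_two hp2).pow
  unfold padicGammaSeq
  push_cast
  rw [hprod, hodd.neg_one_pow, ← Units.coe_prod, prod_units_zmod_prime_pow p hp2 n]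
  simp

theorem padicGammaSeq_add_prime_pow (p : ℕ) [Fact p.Prime] (hp2 : p ≠ 2) {n : ℕ} (hn : n ≠ 0)
    (m : ℕ) : (padicGammaSeq p (m + p ^ n) : ZMod (p ^ n)) = padicGammaSeq p m := by
  induction m with
  | zero => rw [zero_add, padicGammaSeq_prime_pow p hp2 hn]; simp [padicGammaSeq]
  | succ m ih =>
    have hc : Nat.Coprime (m + p ^ n) p ↔ Nat.Coprime m p := by
      obtain ⟨r, rfl⟩ := Nat.exists_eq_succ_of_ne_zero hn
      rw [Nat.succ_eq_add_one, pow_succ, Nat.coprime_add_mul_right_left]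
    rw [add_right_comm, padicGammaSeq_succ, padicGammaSeq_succ]
    push_cast
    rw [ih]
    simp only [hc]
    split_ifs
    · simp [← Nat.cast_pow]
    · simp

theorem padicGammaSeq_congr (p : ℕ) [Fact p.Prime] (hp2 : p ≠ 2) {n : ℕ} (hn : n ≠ 0)
    {a b : ℕ} (h : a ≡ b [MOD p ^ n]) :
    (padicGammaSeq p a : ZMod (p ^ n)) = padicGammaSeq p b := by
  have hmul : ∀ c t : ℕ, (padicGammaSeq p (c + p ^ n * t) : ZMod (p ^ n)) = padicGammaSeq p c := by
    intro c t
    induction t with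
    | zero => simp
    | succ t ih => rw [Nat.mul_succ, ← add_assoc, padicGammaSeq_add_prime_pow p hp2 hn, ih]
  rw [← Nat.mod_add_div a (p ^ n), ← Nat.mod_add_div b (p ^ n), hmul, hmul, h]

theorem comap_natCast_nhds_neBot (p : ℕ) [Fact p.Prime] (x : ℤ_[p]) :
    (Filter.comap (Nat.cast : ℕ → ℤ_[p]) (nhds x)).NeBot := by
  rw [Filter.comap_neBot_iff_frequently, ← mem_closure_iff_frequently]
  exact PadicInt.denseRange_natCast x

/-- For odd `p`, the limit that defines the `p`-adic Gamma function exists. -/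
theorem tendsto_padicGamma (p : ℕ) [Fact p.Prime] (hp2 : p ≠ 2) (x : ℤ_[p]) :
    Filter.Tendsto (fun m : ℕ => (padicGammaSeq p m : ℤ_[p]))
      (Filter.comap (Nat.cast : ℕ → ℤ_[p]) (nhds x)) (nhds (padicGamma p x)) := by
  have hp := (Fact.out : p.Prime)
  have := comap_natCast_nhds_neBot p x
  refine tendsto_nhds_limUnder (cauchy_map_iff_exists_tendsto.mp ?_)
  rw [Metric.cauchy_iff]
  refine ⟨inferInstance, fun ε hε => ?_⟩
  obtain ⟨n, hn⟩ := PadicInt.exists_pow_neg_lt p hε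
  have hn' : (p : ℝ) ^ (-((n + 1 : ℕ) : ℤ)) < ε := by
    refine lt_of_le_of_lt (zpow_le_zpow_right₀ (by exact_mod_cast hp.one_le) ?_) hn
    push_cast; omega
  have hpos : 0 < (p : ℝ) ^ (-((n + 1 : ℕ) : ℤ)) := zpow_pos (by exact_mod_cast hp.pos) _
  refine ⟨(fun m : ℕ => (padicGammaSeq p m : ℤ_[p])) ''
    ((Nat.cast : ℕ → ℤ_[p]) ⁻¹' Metric.closedBall x ((p : ℝ) ^ (-((n + 1 : ℕ) : ℤ)))),
    Filter.image_mem_map (Filter.preimage_mem_comap (Metric.closedBall_mem_nhds x hpos)), ?_⟩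
  rintro _ ⟨a, ha, rfl⟩ _ ⟨b, hb, rfl⟩
  refine lt_of_le_of_lt ?_ hn'
  simp only [Set.mem_preimage, Metric.mem_closedBall] at ha hb
  have hab : ‖((((a : ℤ) - (b : ℤ) : ℤ)) : ℤ_[p])‖ ≤ (p : ℝ) ^ (-((n + 1 : ℕ) : ℤ)) := by
    have h := PadicInt.nonarchimedean ((a : ℤ_[p]) - x) (x - b)
    rw [sub_add_sub_cancel, ← dist_eq_norm, ← dist_eq_norm, ← dist_eq_norm, dist_comm x] at h
    push_cast
    rw [← dist_eq_norm]
    exact h.trans (max_le ha hb)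
  rw [PadicInt.norm_int_le_pow_iff_dvd] at hab
  have hmod : b ≡ a [MOD p ^ (n + 1)] := (Nat.modEq_iff_dvd).mpr (by exact_mod_cast hab)
  have hc := padicGammaSeq_congr p hp2 (Nat.succ_ne_zero n) hmod
  rw [ZMod.intCast_eq_intCast_iff_dvd_sub] at hc
  rw [dist_eq_norm, ← Int.cast_sub, PadicInt.norm_int_le_pow_iff_dvd]
  exact_mod_cast hc

/-- For odd `p`, `Ring.inverse 4` is the `p`-adic integer `1/4`. -/
theorem coe_inverse_four (p : ℕ) [Fact p.Prime] (hp2 : p ≠ 2) :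
    ((Ring.inverse 4 : ℤ_[p]) : ℚ_[p]) = 1 / 4 := by
  have hc : Nat.Coprime p 4 :=
    ((Nat.coprime_primes Fact.out Nat.prime_two).mpr hp2).pow_right 2
  have hu : IsUnit (4 : ℤ_[p]) := by
    rw [PadicInt.isUnit_iff]
    exact_mod_cast PadicInt.norm_natCast_eq_one_iff.mpr hc
  have h := congrArg (fun y : ℤ_[p] => (y : ℚ_[p])) (Ring.mul_inverse_cancel (4 : ℤ_[p]) hu)
  push_cast at h
  exact eq_one_div_of_mul_eq_one_right h

/-! Put `m = (p - 1) / 2`, an odd number `2 * r + 1`. Each factor `((j + 1/2) / (j + 1)) ^ 5` of the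
summand can be deformed to `(j + 1/2) / (j + 1)` times `((j + 1/2)⁴ - p⁴/16) / ((j + 1)⁴ - p⁴/16)`.
All numbers `j + 1/2` and `j + 1` that occur are `p`-adic units, so the sum does not change modulo
`p⁴` (`norm_sum_sub_wellPoisedSum_le`).

The deformed sum is a terminating very-well-poised series with parameter `s = -p²/4`. A two-step
recurrence in `m`, found by creative telescoping, puts it in closed form (`wellPoisedSum_odd`): `(4
* r + 3) * (s / 4) = -p³/16` times a quotient of products. The prefactor already carries `p³`, so
the quotient is needed only modulo `p`. There it is `r! ^ 4` by Wilson and Fermat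
(`norm_prod_ratio_sub_factorial_pow_le`), hence `Γ_p(1/4) ^ 4`, because `1/4 ≡ r + 1`
(`norm_padicGamma_quarter_pow_sub_le`). -/

/-! ### A terminating very-well-poised summation. -/

section Identity

variable {K : Type*} [Field K]

/-- The well-poised hypergeometric term
`(1/2)ₙ (1/2+√s)ₙ (1/2-√s)ₙ (-m)ₙ (m+1)ₙ / (n! (1+√s)ₙ (1-√s)ₙ (1/2-m)ₙ (3/2+m)ₙ)`, with sign. -/
def wellPoisedTerm (s : K) (m n : ℕ) : K :=
  ∏ j ∈ Finset.range n, -(((j : K) + 1 / 2) * (((j : K) + 1 / 2) ^ 2 - s) * ((j - m) * (j + m + 1)) /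
    ((j + 1) * (((j : K) + 1) ^ 2 - s) * ((j + 1 / 2 - m) * (j + 3 / 2 + m))))

/-- The common hypergeometric factor of `wellPoisedTerm s m` and `wellPoisedTerm s (m + 2)`. -/
def wellPoisedKernel (s : K) (m n : ℕ) : K :=
  ∏ j ∈ Finset.range n, -(((j : K) + 1 / 2) * (((j : K) + 1 / 2) ^ 2 - s) * ((j - m - 2) * (j + m + 1)) /
    ((j + 1) * (((j : K) + 1) ^ 2 - s) * ((j + 1 / 2 - m) * (j + 7 / 2 + m))))

theorem wellPoisedTerm_eq_zero (s : K) {m n : ℕ} (h : m < n) : wellPoisedTerm s m n = 0 :=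
  Finset.prod_eq_zero (Finset.mem_range.mpr h) (by simp)

theorem wellPoisedKernel_eq_zero (s : K) {m n : ℕ} (h : m + 2 < n) : wellPoisedKernel s m n = 0 :=
  Finset.prod_eq_zero (Finset.mem_range.mpr h) (by push_cast; simp)

variable [CharZero K]

theorem natCast_add_half_sub_ne_zero (a b : ℕ) : (a : K) + 1 / 2 - b ≠ 0 := by
  intro h
  have h1 : ((2 * a + 1 : ℕ) : K) = ((2 * b : ℕ) : K) := by
    push_cast; linear_combination 2 * h
  have := Nat.cast_injective h1
  omega

theorem natCast_add_half_ne_zero (a : ℕ) : (a : K) + 1 / 2 ≠ 0 := by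
  simpa using natCast_add_half_sub_ne_zero (K := K) a 0

/-- The two products differ only in shifted linear factors, whose quotient telescopes to a rational
function of `n`. Cleared of denominators, the relation survives at `n = m + 1, m + 2`, where the
term vanishes but the kernel need not. -/
theorem wellPoisedTerm_eq_kernel (s : K) (m n : ℕ) :
    ((m : K) + 1) * (m + 2) * (m + 3 / 2) * (m + 5 / 2) * wellPoisedTerm s m n =
      (m + 1 - n) * (m + 2 - n) * (n + m + 3 / 2) * (n + m + 5 / 2) * wellPoisedKernel s m n := by
  induction n with
  | zero => simp [wellPoisedTerm, wellPoisedKernel]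
  | succ n ih =>
    rw [wellPoisedTerm, wellPoisedKernel, Finset.prod_range_succ, Finset.prod_range_succ,
      ← wellPoisedTerm, ← wellPoisedKernel, ← mul_assoc, ih]
    have h1 := natCast_add_half_sub_ne_zero (K := K) n m
    have h2 : (n : K) + 3 / 2 + m ≠ 0 := by
      have := natCast_add_half_ne_zero (K := K) (n + m + 1)
      push_cast at this; convert this using 1; ring
    have h3 : (n : K) + 7 / 2 + m ≠ 0 := by
      have := natCast_add_half_ne_zero (K := K) (n + m + 3)
      push_cast at this; convert this using 1; ring
    have e1 : ((n : K) - m) * (n + m + 1) / ((n + 1 / 2 - m) * (n + 3 / 2 + m)) *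
        ((m + 1 - n) * (m + 2 - n) * (n + m + 3 / 2) * (n + m + 5 / 2)) =
        ((n : K) - m - 2) * (n + m + 1) / ((n + 1 / 2 - m) * (n + 7 / 2 + m)) *
        ((m + 1 - (n + 1)) * (m + 2 - (n + 1)) * (n + 1 + m + 3 / 2) * (n + 1 + m + 5 / 2)) := by
      rw [div_mul_eq_mul_div, div_mul_eq_mul_div,
        div_eq_div_iff (mul_ne_zero h1 h2) (mul_ne_zero h1 h3)]
      ring
    push_cast
    rw [mul_div_mul_comm, mul_div_mul_comm _ (((n : K) - m - 2) * (n + m + 1))]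
    linear_combination -(((n : K) + 1 / 2) * (((n : K) + 1 / 2) ^ 2 - s) / ((n + 1) * (((n : K) + 1) ^ 2 - s)))
      * wellPoisedKernel s m n * e1

theorem wellPoisedTerm_add_two_eq_kernel (s : K) (m n : ℕ) :
    ((m : K) + 1) * (m + 2) * (m + 1 / 2) * (m + 3 / 2) * wellPoisedTerm s (m + 2) n =
      (m + n + 1) * (m + n + 2) * (m + 1 / 2 - n) * (m + 3 / 2 - n) * wellPoisedKernel s m n := by
  induction n with
  | zero => simp [wellPoisedTerm, wellPoisedKernel]
  | succ n ih =>
    rw [wellPoisedTerm, wellPoisedKernel, Finset.prod_range_succ, Finset.prod_range_succ,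
      ← wellPoisedTerm, ← wellPoisedKernel, ← mul_assoc, ih]
    have h1 := natCast_add_half_sub_ne_zero (K := K) n m
    have h2 : (n : K) + 1 / 2 - (m + 2) ≠ 0 := by
      have := natCast_add_half_sub_ne_zero (K := K) n (m + 2)
      exact_mod_cast this
    have h3 : (n : K) + 7 / 2 + m ≠ 0 := by
      have := natCast_add_half_ne_zero (K := K) (n + m + 3)
      push_cast at this; convert this using 1; ring
    have h4 : (n : K) + 3 / 2 + (m + 2) ≠ 0 := by convert h3 using 1; ring
    have e1 : ((n : K) - (m + 2)) * (n + (m + 2) + 1) / ((n + 1 / 2 - (m + 2)) * (n + 3 / 2 + (m + 2))) *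
        ((m + n + 1) * (m + n + 2) * (m + 1 / 2 - n) * (m + 3 / 2 - n)) =
        ((n : K) - m - 2) * (n + m + 1) / ((n + 1 / 2 - m) * (n + 7 / 2 + m)) *
        ((m + (n + 1) + 1) * (m + (n + 1) + 2) * (m + 1 / 2 - (n + 1)) * (m + 3 / 2 - (n + 1))) := by
      rw [div_mul_eq_mul_div, div_mul_eq_mul_div,
        div_eq_div_iff (mul_ne_zero h2 h4) (mul_ne_zero h1 h3)]
      ring
    push_cast
    rw [mul_div_mul_comm, mul_div_mul_comm _ (((n : K) - m - 2) * (n + m + 1))]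
    linear_combination -(((n : K) + 1 / 2) * (((n : K) + 1 / 2) ^ 2 - s) / ((n + 1) * (((n : K) + 1) ^ 2 - s)))
      * wellPoisedKernel s m n * e1

/-- This is the Zeilberger certificate of the recurrence: the bracket is the combination of the
terms for `m + 2` and `m` written over the common kernel, and the right side is its antidifference.
-/
theorem sum_wellPoised_telescope {s : K} (hs : ∀ n : ℕ, ((n : K) + 1) ^ 2 - s ≠ 0) (m N : ℕ) :
    ∑ n ∈ Finset.range N, (4 * (n : K) + 1) * wellPoisedKernel s m n *
      (((m + 2) ^ 2 - s) * ((m + n + 1) * (m + n + 2) * (m + 1 / 2 - n) * (m + 3 / 2 - n)) -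
        ((m + 1) ^ 2 - s) * ((m + 1 - n) * (m + 2 - n) * (n + m + 3 / 2) * (n + m + 5 / 2))) =
      -(2 * (2 * m + 3)) * (N * ((N : K) ^ 2 - s) * (N - 1 / 2 - m) * (N + m + 5 / 2)) *
        wellPoisedKernel s m N := by
  induction N with
  | zero => simp
  | succ n ih =>
    rw [Finset.sum_range_succ, ih]
    have e : wellPoisedKernel s m (n + 1) *
        ((n + 1) * (((n : K) + 1) ^ 2 - s) * ((n + 1 / 2 - m) * (n + 7 / 2 + m))) =
        -(((n : K) + 1 / 2) * (((n : K) + 1 / 2) ^ 2 - s) * ((n - m - 2) * (n + m + 1))) *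
        wellPoisedKernel s m n := by
      have h3 : (n : K) + 7 / 2 + m ≠ 0 := by
        have := natCast_add_half_ne_zero (K := K) (n + m + 3)
        push_cast at this; convert this using 1; ring
      have h0 : ((n + 1) * (((n : K) + 1) ^ 2 - s) * ((n + 1 / 2 - m) * (n + 7 / 2 + m))) ≠ 0 :=
        mul_ne_zero (mul_ne_zero (by exact_mod_cast n.succ_ne_zero) (hs n))
          (mul_ne_zero (natCast_add_half_sub_ne_zero n m) h3)
      rw [wellPoisedKernel, Finset.prod_range_succ, ← wellPoisedKernel, ← neg_div, mul_assoc,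
        div_mul_cancel₀ _ h0, mul_comm]
    push_cast
    linear_combination 2 * (2 * (m : K) + 3) * e

/-- The terminating very-well-poised sum. -/
def wellPoisedSum (s : K) (m : ℕ) : K :=
  ∑ n ∈ Finset.range (m + 1), (4 * (n : K) + 1) * wellPoisedTerm s m n

theorem wellPoisedSum_add_two {s : K} (hs : ∀ n : ℕ, ((n : K) + 1) ^ 2 - s ≠ 0) (m : ℕ) :
    (2 * (m : K) + 1) * ((m + 2) ^ 2 - s) * wellPoisedSum s (m + 2) =
      (2 * m + 5) * ((m + 1) ^ 2 - s) * wellPoisedSum s m := by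
  have hext : wellPoisedSum s m =
      ∑ n ∈ Finset.range (m + 2 + 1), (4 * (n : K) + 1) * wellPoisedTerm s m n := by
    refine Finset.sum_subset (Finset.range_mono (by omega)) fun n _ hn => ?_
    rw [wellPoisedTerm_eq_zero s (by simpa using hn), mul_zero]
  have ht := sum_wellPoised_telescope hs m (m + 2 + 1)
  -- At `N = m + 3` the boundary term contains the factor `j - m - 2` with `j = m + 2`.
  rw [wellPoisedKernel_eq_zero s (Nat.lt_succ_self _), mul_zero] at ht
  have h1 : (m : K) + 1 ≠ 0 := by exact_mod_cast m.succ_ne_zero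
  have h2 : (m : K) + 2 ≠ 0 := by exact_mod_cast (m + 1).succ_ne_zero
  have h3 : (m : K) + 3 / 2 ≠ 0 := by
    have := natCast_add_half_ne_zero (K := K) (m + 1)
    push_cast at this; convert this using 1; ring
  refine mul_left_cancel₀ (mul_ne_zero (mul_ne_zero h1 h2) h3) ?_
  refine mul_left_cancel₀ (two_ne_zero (α := K)) ?_
  rw [hext, wellPoisedSum, ← sub_eq_zero]
  refine Eq.trans ?_ ((congrArg (4 * ·) ht).trans (mul_zero 4))
  simp only [Finset.mul_sum, ← Finset.sum_sub_distrib]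
  refine Finset.sum_congr rfl fun n _ => ?_
  linear_combination 4 * (4 * (n : K) + 1) * ((m + 2) ^ 2 - s) * wellPoisedTerm_add_two_eq_kernel s m n
    - 4 * (4 * (n : K) + 1) * ((m + 1) ^ 2 - s) * wellPoisedTerm_eq_kernel s m n

/-- The recurrence preserves the parity of `m`; the factor `s` comes from the initial value
`wellPoisedSum s 1 = 3 * s / (1 - s)`. -/
theorem wellPoisedSum_odd {s : K} (hs : ∀ n : ℕ, ((n : K) + 1) ^ 2 - s ≠ 0) (r : ℕ) :
    wellPoisedSum s (2 * r + 1) = (4 * r + 3) * (s / 4) *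
      ((∏ j ∈ Finset.range r, (((j : K) + 1) ^ 2 - s / 4)) /
        ∏ j ∈ Finset.range (r + 1), (((j : K) + 1 / 2) ^ 2 - s / 4)) := by
  have hd : ∀ j : ℕ, ((j : K) + 1 / 2) ^ 2 - s / 4 ≠ 0 := by
    intro j h
    apply hs (2 * j)
    push_cast
    linear_combination 4 * h
  induction r with
  | zero =>
    have h0 := hs 0
    have h1 := hd 0
    have h0' : (1 : K) - s ≠ 0 := by simpa using h0
    have h1' : (1 : K) - s = 4 * ((1 / 2) ^ 2 - s / 4) := by ring
    simp only [wellPoisedSum, wellPoisedTerm, Finset.sum_range_succ, Finset.prod_range_succ,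
      Finset.sum_range_zero, Finset.prod_range_zero, Nat.cast_zero, Nat.cast_one, mul_zero, zero_add,
      one_pow, one_mul]
    have h3 : (1 / 2 : K) ^ 2 - s / 4 = (1 - s) / 4 := by ring
    rw [h3]
    norm_num
    field_simp
    ring
  | succ r ih =>
    have hrec := wellPoisedSum_add_two hs (2 * r + 1)
    rw [ih] at hrec
    have h1 : (2 * ((2 * r + 1 : ℕ) : K) + 1) * ((((2 * r + 1 : ℕ) : K) + 2) ^ 2 - s) ≠ 0 := by
      refine mul_ne_zero ?_ ?_
      · exact_mod_cast (2 * (2 * r + 1)).succ_ne_zero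
      · have := hs (2 * r + 2)
        push_cast at this ⊢; convert this using 2; ring
    rw [show 2 * (r + 1) + 1 = 2 * r + 1 + 2 by ring]
    refine mul_left_cancel₀ h1 (hrec.trans ?_)
    rw [Finset.prod_range_succ (fun j : ℕ => ((j : K) + 1) ^ 2 - s / 4) r,
      Finset.prod_range_succ (fun j : ℕ => ((j : K) + 1 / 2) ^ 2 - s / 4) (r + 1)]
    have hY : ∏ j ∈ Finset.range (r + 1), (((j : K) + 1 / 2) ^ 2 - s / 4) ≠ 0 :=
      Finset.prod_ne_zero_iff.mpr fun j _ => hd j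
    have hl := hd (r + 1)
    simp only [mul_div_assoc']
    rw [div_eq_div_iff hY (mul_ne_zero hY hl)]
    push_cast
    ring

end Identity

/-! ### Congruences as norm bounds in an ultrametric field. -/

section Ultrametric

variable {K : Type*} [NormedField K] [IsUltrametricDist K]

theorem norm_mul_sub_mul_le {a a' b b' : K} {ε : ℝ} (ha : ‖a‖ ≤ 1) (hb' : ‖b'‖ ≤ 1)
    (haa : ‖a - a'‖ ≤ ε) (hbb : ‖b - b'‖ ≤ ε) : ‖a * b - a' * b'‖ ≤ ε := by
  have hε := (norm_nonneg _).trans haa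
  have e : a * b - a' * b' = a * (b - b') + (a - a') * b' := by ring
  rw [e]
  refine (IsUltrametricDist.norm_add_le_max _ _).trans (max_le ?_ ?_)
  · rw [norm_mul]; exact (mul_le_mul ha hbb (norm_nonneg _) zero_le_one).trans_eq (one_mul ε)
  · rw [norm_mul]; exact (mul_le_mul haa hb' (norm_nonneg _) hε).trans_eq (mul_one ε)

theorem norm_pow_sub_pow_le {a a' : K} {ε : ℝ} (ha : ‖a‖ ≤ 1) (ha' : ‖a'‖ ≤ 1)
    (haa : ‖a - a'‖ ≤ ε) (n : ℕ) : ‖a ^ n - a' ^ n‖ ≤ ε := by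
  induction n with
  | zero => simpa using (norm_nonneg _).trans haa
  | succ n ih =>
    rw [pow_succ, pow_succ]
    exact norm_mul_sub_mul_le (by rw [norm_pow]; exact pow_le_one₀ (norm_nonneg _) ha) ha' ih haa

theorem norm_prod_sub_prod_le {ι : Type*} {s : Finset ι} {a b : ι → K} {ε : ℝ} (hε : 0 ≤ ε)
    (ha : ∀ i ∈ s, ‖a i‖ ≤ 1) (hb : ∀ i ∈ s, ‖b i‖ ≤ 1) (hab : ∀ i ∈ s, ‖a i - b i‖ ≤ ε) :
    ‖∏ i ∈ s, a i - ∏ i ∈ s, b i‖ ≤ ε := by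
  classical
  induction s using Finset.induction_on with
  | empty => simpa using hε
  | insert i s hi ih =>
    simp only [Finset.mem_insert, forall_eq_or_imp] at ha hb hab
    rw [Finset.prod_insert hi, Finset.prod_insert hi]
    refine norm_mul_sub_mul_le ha.1 ?_ hab.1 (ih ha.2 hb.2 hab.2)
    rw [norm_prod]
    exact Finset.prod_le_one (fun _ _ => norm_nonneg _) hb.2

theorem norm_sub_of_norm_lt_one {b q : K} (hb : ‖b‖ = 1) (hq : ‖q‖ < 1) : ‖b - q‖ = 1 := by
  have h := IsUltrametricDist.norm_add_eq_max_of_norm_ne_norm (x := b) (y := -q)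
    (by rw [norm_neg, hb]; exact hq.ne')
  rw [sub_eq_add_neg, h, norm_neg, hb, max_eq_left hq.le]

theorem norm_div_sub_div_le {a a' b b' : K} {ε : ℝ} (ha : ‖a‖ ≤ 1) (hb : ‖b‖ = 1) (hb' : ‖b'‖ = 1)
    (haa : ‖a - a'‖ ≤ ε) (hbb : ‖b - b'‖ ≤ ε) : ‖a / b - a' / b'‖ ≤ ε := by
  have h0 : b ≠ 0 := norm_ne_zero_iff.mp (by rw [hb]; exact one_ne_zero)
  have h0' : b' ≠ 0 := norm_ne_zero_iff.mp (by rw [hb']; exact one_ne_zero)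
  rw [div_sub_div _ _ h0 h0', norm_div, norm_mul b, hb, hb', mul_one, div_one, mul_comm b]
  exact norm_mul_sub_mul_le ha hb.le haa (by rwa [norm_sub_rev])
end Ultrametric

/-! ### Wilson's theorem at the half, and values of `Γ_p`. -/

section Gamma

/-- If `p = 2 m + 1` is prime, then `(m!)² ≡ (-1)^(m+1)` modulo `p`. -/
theorem ZMod.sq_factorial_half {p m : ℕ} [Fact p.Prime] (hm : p = 2 * m + 1) :
    ((m.factorial : ZMod p)) ^ 2 = (-1) ^ (m + 1) := by
  have hw := ZMod.wilsons_lemma p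
  have h1 : p - 1 = m + m := by omega
  -- Modulo `p`, the upper half `m + 1, …, 2m` of the factors of `(p - 1)!` is the negated lower
  -- half in reverse order.
  have hprod : ((m + 1).ascFactorial m : ZMod p) = (-1) ^ m * m.factorial := by
    rw [Nat.ascFactorial_eq_prod_range, ← Finset.prod_range_add_one_eq_factorial,
      ← Finset.prod_range_reflect (fun i => i + 1)]
    push_cast
    rw [show ((-1 : ZMod p)) ^ m = ∏ j ∈ Finset.range m, (-1 : ZMod p) by simp, ← Finset.prod_mul_distrib]
    refine Finset.prod_congr rfl fun j hj => ?_
    have hj' := Finset.mem_range.mp hj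
    have h2 : ((m + 1 + j : ℕ) : ZMod p) + ((m - 1 - j + 1 : ℕ) : ZMod p) = 0 := by
      rw [← Nat.cast_add, show m + 1 + j + (m - 1 - j + 1) = p by omega, ZMod.natCast_self]
    push_cast at h2 ⊢
    linear_combination h2
  rw [h1, ← Nat.factorial_mul_ascFactorial, Nat.cast_mul, hprod] at hw
  have h3 : ((-1 : ZMod p) ^ m) * (-1) ^ m = 1 := by rw [← mul_pow]; simp
  rw [pow_succ]
  linear_combination (-1) ^ m * hw - (m.factorial : ZMod p) ^ 2 * h3

theorem padicGammaSeq_add_one_of_lt {p n : ℕ} [Fact p.Prime] (h : n < p) :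
    padicGammaSeq p (n + 1) = (-1) ^ (n + 1) * (n.factorial : ℤ) := by
  induction n with
  | zero => simp [padicGammaSeq, show Finset.Ioo 0 1 = (∅ : Finset ℕ) by decide]
  | succ n ih =>
    have hc : Nat.Coprime (n + 1) p :=
      (Nat.coprime_of_lt_prime n.succ_ne_zero h Fact.out).symm
    rw [padicGammaSeq_succ, ih (by omega), if_pos hc, Nat.factorial_succ]
    push_cast
    ring

/-- The periodicity of `padicGammaSeq` modulo `p ^ n` passes to the limit, so `Γ_p(x)` modulo `p ^
n` can be read off at any natural number congruent to `x`. -/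
theorem norm_padicGamma_sub_padicGammaSeq_le {p : ℕ} [Fact p.Prime] (hp2 : p ≠ 2) {n : ℕ}
    (hn : n ≠ 0) {x : ℤ_[p]} {a : ℕ} (ha : ‖x - a‖ ≤ (p : ℝ) ^ (-n : ℤ)) :
    ‖padicGamma p x - padicGammaSeq p a‖ ≤ (p : ℝ) ^ (-n : ℤ) := by
  have := comap_natCast_nhds_neBot p x
  have hpos : 0 < (p : ℝ) ^ (-n : ℤ) :=
    zpow_pos (by exact_mod_cast (Fact.out : p.Prime).pos) _
  have ht := ((tendsto_padicGamma p hp2 x).sub_const (padicGammaSeq p a : ℤ_[p])).norm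
  refine le_of_tendsto ht ?_
  filter_upwards [Filter.preimage_mem_comap (Metric.closedBall_mem_nhds x hpos)] with b hb
  have hb' : ‖(b : ℤ_[p]) - x‖ ≤ (p : ℝ) ^ (-n : ℤ) := by
    simpa [dist_eq_norm] using hb
  have hab : ‖(((b : ℤ) - (a : ℤ) : ℤ) : ℤ_[p])‖ ≤ (p : ℝ) ^ (-n : ℤ) := by
    have h := PadicInt.nonarchimedean ((b : ℤ_[p]) - x) (x - a)
    rw [sub_add_sub_cancel] at h
    push_cast
    exact h.trans (max_le hb' ha)
  rw [PadicInt.norm_int_le_pow_iff_dvd] at hab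
  have hmod : a ≡ b [MOD p ^ n] := (Nat.modEq_iff_dvd).mpr (by exact_mod_cast hab)
  have hc := padicGammaSeq_congr p hp2 hn hmod
  rw [ZMod.intCast_eq_intCast_iff_dvd_sub] at hc
  rw [← Int.cast_sub, PadicInt.norm_int_le_pow_iff_dvd]
  exact_mod_cast hc

end Gamma

/-! ### Reduction modulo `p⁴`, and the closed form modulo `p`. -/

section Supercongruence

variable {p : ℕ} [Fact p.Prime]

theorem norm_natCast_add_half {j : ℕ} (hp2 : p ≠ 2) (hj : 2 * j + 1 < p) : ‖(j : ℚ_[p]) + 1 / 2‖ = 1 := by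
  have h2 : ‖((2 : ℕ) : ℚ_[p])‖ = 1 := Padic.norm_natCast_eq_one_iff.mpr
    ((Nat.coprime_primes Fact.out Nat.prime_two).mpr hp2)
  have h1 : ‖((2 * j + 1 : ℕ) : ℚ_[p])‖ = 1 := Padic.norm_natCast_eq_one_iff.mpr
    (Nat.coprime_of_lt_prime (by omega) hj Fact.out)
  have e : (j : ℚ_[p]) + 1 / 2 = ((2 * j + 1 : ℕ) : ℚ_[p]) / ((2 : ℕ) : ℚ_[p]) := by
    push_cast; field_simp
  rw [e, norm_div, h1, h2, div_one]

theorem norm_natCast_add_one {j : ℕ} (hj : j + 1 < p) : ‖(j : ℚ_[p]) + 1‖ = 1 := by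
  have h1 : ‖((j + 1 : ℕ) : ℚ_[p])‖ = 1 := Padic.norm_natCast_eq_one_iff.mpr
    (Nat.coprime_of_lt_prime (by omega) hj Fact.out)
  exact_mod_cast h1

theorem norm_sixteen (hp2 : p ≠ 2) : ‖(16 : ℚ_[p])‖ = 1 := by
  have h2 : ‖((2 ^ 4 : ℕ) : ℚ_[p])‖ = 1 := Padic.norm_natCast_eq_one_iff.mpr
    (((Nat.coprime_primes Fact.out Nat.prime_two).mpr hp2).pow_right 4)
  norm_num at h2
  exact h2

theorem eval_ascPochhammer_half_div_factorial (k : ℕ) :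
    (ascPochhammer ℚ_[p] k).eval (1 / 2) / (k.factorial : ℚ_[p]) =
      ∏ j ∈ Finset.range k, ((j : ℚ_[p]) + 1 / 2) / (j + 1) := by
  induction k with
  | zero => simp
  | succ k ih =>
    rw [Finset.prod_range_succ, ← ih, ascPochhammer_succ_eval, Nat.factorial_succ]
    push_cast
    rw [mul_comm ((k : ℚ_[p]) + 1), div_mul_div_comm, add_comm (k : ℚ_[p]) (1 / 2)]

/-- With `s = -p²/4` the deformed term only involves `p⁴`. -/
theorem wellPoisedTerm_eq_prod {m : ℕ} (hm : p = 2 * m + 1) (k : ℕ) :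
    wellPoisedTerm (-((p : ℚ_[p]) ^ 2 / 4)) m k =
      (-1) ^ k * ∏ j ∈ Finset.range k, (((j : ℚ_[p]) + 1 / 2) / (j + 1) *
        ((((j : ℚ_[p]) + 1 / 2) ^ 4 - (p : ℚ_[p]) ^ 4 / 16) /
          (((j : ℚ_[p]) + 1) ^ 4 - (p : ℚ_[p]) ^ 4 / 16))) := by
  have hp : (p : ℚ_[p]) = 2 * m + 1 := by exact_mod_cast congrArg (Nat.cast (R := ℚ_[p])) hm
  have hs : ((-1 : ℚ_[p])) ^ k = ∏ j ∈ Finset.range k, (-1 : ℚ_[p]) := by simp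
  rw [wellPoisedTerm, hs, ← Finset.prod_mul_distrib]
  refine Finset.prod_congr rfl fun j _ => ?_
  -- From `p = 2 * m + 1`, `(j - m)(j + m + 1) = (j + 1/2)² - p²/4` and `(j + 1/2 - m)(j + 3/2 + m)
  -- = (j + 1)² - p²/4`. Each pairs with its `+ p²/4` counterpart coming from `-s`.
  rw [neg_one_mul, div_mul_div_comm]
  congr 2
  · rw [hp]; ring
  · rw [hp]; ring

theorem norm_sum_sub_wellPoisedSum_le {m : ℕ} (hm : p = 2 * m + 1) :
    ‖∑ k ∈ Finset.range (m + 1), (-1 : ℚ_[p]) ^ k * (4 * (k : ℚ_[p]) + 1) *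
        ((ascPochhammer ℚ_[p] k).eval (1 / 2) / (k.factorial : ℚ_[p])) ^ 5 -
      wellPoisedSum (-((p : ℚ_[p]) ^ 2 / 4)) m‖ ≤ (p : ℝ) ^ (-4 : ℤ) := by
  have hp2 : p ≠ 2 := by omega
  have hp1 : 1 < (p : ℝ) := by exact_mod_cast (Fact.out : p.Prime).one_lt
  have hε : 0 ≤ (p : ℝ) ^ (-4 : ℤ) := zpow_nonneg (by positivity) _
  have hε1 : (p : ℝ) ^ (-4 : ℤ) < 1 := zpow_lt_one_of_neg₀ hp1 (by norm_num)
  have hq : ‖(p : ℚ_[p]) ^ 4 / 16‖ = (p : ℝ) ^ (-4 : ℤ) := by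
    rw [norm_div, norm_sixteen hp2, div_one, Padic.norm_p_pow]; rfl
  rw [wellPoisedSum, ← Finset.sum_sub_distrib]
  refine IsUltrametricDist.norm_sum_le_of_forall_le_of_nonneg hε fun k hk => ?_
  have hk' := Finset.mem_range.mp hk
  rw [wellPoisedTerm_eq_prod hm, eval_ascPochhammer_half_div_factorial, ← Finset.prod_pow]
  have e : ∀ x y : ℚ_[p], (-1) ^ k * (4 * (k : ℚ_[p]) + 1) * x - (4 * (k : ℚ_[p]) + 1) * ((-1) ^ k * y)
      = (-1) ^ k * ((4 * k + 1 : ℕ) : ℚ_[p]) * (x - y) := by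
    intro x y; push_cast; ring
  rw [e, norm_mul, norm_mul, norm_pow, norm_neg, norm_one, one_pow, one_mul]
  refine (mul_le_mul (by simpa using Padic.norm_int_le_one (p := p) ((4 * k + 1 : ℕ) : ℤ)) ?_
    (norm_nonneg _) zero_le_one).trans_eq (one_mul _)
  have ha : ∀ j ∈ Finset.range k, ‖(j : ℚ_[p]) + 1 / 2‖ = 1 := fun j hj =>
    norm_natCast_add_half hp2 (by have := Finset.mem_range.mp hj; omega)
  have hb : ∀ j ∈ Finset.range k, ‖(j : ℚ_[p]) + 1‖ = 1 := fun j hj =>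
    norm_natCast_add_one (by have := Finset.mem_range.mp hj; omega)
  have hsub : ∀ x : ℚ_[p], ‖x‖ = 1 → ‖x ^ 4 - (p : ℚ_[p]) ^ 4 / 16‖ = 1 := fun x hx =>
    norm_sub_of_norm_lt_one (by rw [norm_pow, hx, one_pow]) (hq.trans_lt hε1)
  refine norm_prod_sub_prod_le hε (fun j hj => ?_) (fun j hj => ?_) fun j hj => ?_
  · rw [norm_pow, norm_div, ha j hj, hb j hj]; norm_num
  · rw [norm_mul, norm_div, norm_div, ha j hj, hb j hj, hsub _ (ha j hj), hsub _ (hb j hj)]; norm_num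
  -- One factor of the fifth power is common to both sides and is a unit; only the fourth powers are
  -- compared with their shifts by `p⁴/16`.
  · rw [pow_succ', div_pow, ← mul_sub, norm_mul, norm_div, ha j hj, hb j hj, div_one, one_mul]
    have hd : ∀ x : ℚ_[p], ‖x ^ 4 - (x ^ 4 - (p : ℚ_[p]) ^ 4 / 16)‖ ≤ (p : ℝ) ^ (-4 : ℤ) := fun x => by
      rw [sub_sub_cancel, hq]
    exact norm_div_sub_div_le (by rw [norm_pow, ha j hj, one_pow]) (by rw [norm_pow, hb j hj, one_pow])
      (hsub _ (hb j hj)) (hd _) (hd _)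

/-- Split `(2 * r + 1)!` into its even factors, `2 ^ r * r!`, and its odd factors, `2 ^ (r + 1)`
times the product of half-integers. -/
theorem factorial_mul_prod_half (r : ℕ) :
    (r.factorial : ℚ_[p]) * (∏ j ∈ Finset.range (r + 1), ((j : ℚ_[p]) + 1 / 2)) * 2 ^ (2 * r + 1) =
      (2 * r + 1).factorial := by
  induction r with
  | zero => simp
  | succ r ih =>
    rw [Finset.prod_range_succ, show 2 * (r + 1) + 1 = 2 * r + 1 + 1 + 1 by ring,
      Nat.factorial_succ (2 * r + 1 + 1), Nat.factorial_succ (2 * r + 1), Nat.factorial_succ r]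
    push_cast
    rw [← ih]
    ring

/-- Both squares are `1` modulo `p`: the first by Fermat, the second by Wilson because `m` is odd.
-/
theorem norm_two_pow_sq_sub_factorial_sq_le {m : ℕ} (hm : p = 2 * m + 1) (hodd : Odd m) :
    ‖((2 : ℚ_[p]) ^ m) ^ 2 - (m.factorial : ℚ_[p]) ^ 2‖ ≤ (p : ℝ) ^ (-1 : ℤ) := by
  have h2 : (2 : ZMod p) ≠ 0 := by
    intro h
    have : ((2 : ℕ) : ZMod p) = 0 := by exact_mod_cast h
    rw [ZMod.natCast_eq_zero_iff] at this
    have := Nat.le_of_dvd two_pos this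
    have := (Fact.out : p.Prime).one_lt
    omega
  have h : ((((2 : ℤ) ^ m) ^ 2 - (m.factorial : ℤ) ^ 2 : ℤ) : ZMod p) = 0 := by
    push_cast
    rw [ZMod.sq_factorial_half hm, hodd.add_one.neg_one_pow, ← pow_mul,
      show m * 2 = p - 1 by omega, ZMod.pow_card_sub_one_eq_one h2, sub_self]
  rw [ZMod.intCast_zmod_eq_zero_iff_dvd] at h
  have := (Padic.norm_int_le_pow_iff_dvd (p := p) (((2 : ℤ) ^ m) ^ 2 - (m.factorial : ℤ) ^ 2) 1).mpr
    (by simpa using h)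
  exact_mod_cast this

theorem norm_two (hp2 : p ≠ 2) : ‖(2 : ℚ_[p])‖ = 1 := by
  exact_mod_cast Padic.norm_natCast_eq_one_iff.mpr
    ((Nat.coprime_primes Fact.out Nat.prime_two).mpr hp2)

/-- Dropping `q` leaves `r!² / H²`, with `H` the product of half-integers. Since `r! * H * 2 ^ m =
m!` for `m = 2 * r + 1`, this equals `r!⁴ * (2 ^ m)² / m!²`, and the last quotient is `1` modulo
`p`. -/
theorem norm_prod_ratio_sub_factorial_pow_le {r : ℕ} (hr : p = 4 * r + 3) {q : ℚ_[p]}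
    (hq : ‖q‖ ≤ (p : ℝ) ^ (-1 : ℤ)) :
    ‖(∏ j ∈ Finset.range r, (((j : ℚ_[p]) + 1) ^ 2 - q)) /
        (∏ j ∈ Finset.range (r + 1), (((j : ℚ_[p]) + 1 / 2) ^ 2 - q)) -
      (r.factorial : ℚ_[p]) ^ 4‖ ≤ (p : ℝ) ^ (-1 : ℤ) := by
  have hp2 : p ≠ 2 := by omega
  have hp1 : 1 < (p : ℝ) := by exact_mod_cast (Fact.out : p.Prime).one_lt
  have hε : 0 ≤ (p : ℝ) ^ (-1 : ℤ) := zpow_nonneg (by positivity) _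
  have hq1 : ‖q‖ < 1 := hq.trans_lt (zpow_lt_one_of_neg₀ hp1 (by norm_num))
  have ha : ∀ j ∈ Finset.range (r + 1), ‖((j : ℚ_[p]) + 1 / 2) ^ 2‖ = 1 := fun j hj => by
    rw [norm_pow, norm_natCast_add_half hp2 (by have := Finset.mem_range.mp hj; omega), one_pow]
  have hb : ∀ j ∈ Finset.range r, ‖((j : ℚ_[p]) + 1) ^ 2‖ = 1 := fun j hj => by
    rw [norm_pow, norm_natCast_add_one (by have := Finset.mem_range.mp hj; omega), one_pow]
  have hsub : ∀ x : ℚ_[p], ‖x - q - x‖ ≤ (p : ℝ) ^ (-1 : ℤ) := fun x => by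
    rwa [sub_sub_cancel_left, norm_neg]
  have h1 : ‖(∏ j ∈ Finset.range r, (((j : ℚ_[p]) + 1) ^ 2 - q)) /
        (∏ j ∈ Finset.range (r + 1), (((j : ℚ_[p]) + 1 / 2) ^ 2 - q)) -
      (∏ j ∈ Finset.range r, ((j : ℚ_[p]) + 1) ^ 2) /
        (∏ j ∈ Finset.range (r + 1), ((j : ℚ_[p]) + 1 / 2) ^ 2)‖ ≤ (p : ℝ) ^ (-1 : ℤ) := by
    refine norm_div_sub_div_le ?_ ?_ ?_ ?_ ?_
    · rw [norm_prod, Finset.prod_eq_one fun j hj => norm_sub_of_norm_lt_one (hb j hj) hq1]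
    · rw [norm_prod, Finset.prod_eq_one fun j hj => norm_sub_of_norm_lt_one (ha j hj) hq1]
    · rw [norm_prod, Finset.prod_eq_one ha]
    · exact norm_prod_sub_prod_le hε (fun j hj => (norm_sub_of_norm_lt_one (hb j hj) hq1).le)
        (fun j hj => (hb j hj).le) fun _ _ => hsub _
    · exact norm_prod_sub_prod_le hε (fun j hj => (norm_sub_of_norm_lt_one (ha j hj) hq1).le)
        (fun j hj => (ha j hj).le) fun _ _ => hsub _
  have hX : ∏ j ∈ Finset.range r, ((j : ℚ_[p]) + 1) ^ 2 = (r.factorial : ℚ_[p]) ^ 2 := by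
    rw [Finset.prod_pow, ← Finset.prod_range_add_one_eq_factorial]
    push_cast
    rfl
  have hH : ‖∏ j ∈ Finset.range (r + 1), ((j : ℚ_[p]) + 1 / 2)‖ = 1 := by
    rw [norm_prod]
    exact Finset.prod_eq_one fun j hj =>
      norm_natCast_add_half hp2 (by have := Finset.mem_range.mp hj; omega)
  have hf := factorial_mul_prod_half (p := p) r
  have hw := norm_two_pow_sq_sub_factorial_sq_le (p := p) (m := 2 * r + 1) (by omega) ⟨r, rfl⟩
  rw [hX, Finset.prod_pow] at h1
  set H := ∏ j ∈ Finset.range (r + 1), ((j : ℚ_[p]) + 1 / 2)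
  have hH0 : H ≠ 0 := norm_ne_zero_iff.mp (by rw [hH]; exact one_ne_zero)
  have e : (r.factorial : ℚ_[p]) ^ 2 / H ^ 2 - (r.factorial : ℚ_[p]) ^ 4 =
      (r.factorial : ℚ_[p]) ^ 2 / (H ^ 2 * (2 ^ (2 * r + 1)) ^ 2) *
        ((2 ^ (2 * r + 1)) ^ 2 - ((2 * r + 1).factorial : ℚ_[p]) ^ 2) := by
    rw [← hf]
    field_simp
  have h2 : ‖(r.factorial : ℚ_[p]) ^ 2 / H ^ 2 - (r.factorial : ℚ_[p]) ^ 4‖ ≤ (p : ℝ) ^ (-1 : ℤ) := by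
    rw [e, norm_mul, norm_div, norm_mul, norm_pow, norm_pow, norm_pow, norm_pow, hH, norm_two hp2]
    simp only [one_pow, mul_one, div_one]
    exact (mul_le_mul (pow_le_one₀ (norm_nonneg _)
      (by simpa using Padic.norm_int_le_one (p := p) (r.factorial : ℤ))) hw (norm_nonneg _)
      zero_le_one).trans_eq (one_mul _)
  rw [← sub_add_sub_cancel]
  exact (IsUltrametricDist.norm_add_le_max _ _).trans (max_le h1 h2)

/-- Since `1/4 - (r + 1) = -p/4`, `Γ_p(1/4)` is congruent to `Γ_p(r + 1) = ± r!`, and the fourth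
power removes the sign. -/
theorem norm_padicGamma_quarter_pow_sub_le {r : ℕ} (hr : p = 4 * r + 3) :
    ‖((padicGamma p (Ring.inverse 4) : ℤ_[p]) : ℚ_[p]) ^ 4 - (r.factorial : ℚ_[p]) ^ 4‖ ≤
      (p : ℝ) ^ (-1 : ℤ) := by
  have hp2 : p ≠ 2 := by omega
  have hx : ‖(Ring.inverse 4 : ℤ_[p]) - ((r + 1 : ℕ) : ℤ_[p])‖ ≤ (p : ℝ) ^ (-(1 : ℕ) : ℤ) := by
    have hp : (p : ℚ_[p]) = 4 * r + 3 := by exact_mod_cast congrArg (Nat.cast (R := ℚ_[p])) hr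
    have h4 : ‖(4 : ℚ_[p])‖ = 1 := by
      rw [show (4 : ℚ_[p]) = 2 ^ 2 by norm_num, norm_pow, norm_two hp2, one_pow]
    rw [PadicInt.norm_def, PadicInt.coe_sub, coe_inverse_four p hp2, PadicInt.coe_natCast,
      show (1 : ℚ_[p]) / 4 - ((r + 1 : ℕ) : ℚ_[p]) = -(p / 4) by rw [hp]; push_cast; ring, norm_neg,
      norm_div, h4, Padic.norm_p]
    simp
  have h := norm_padicGamma_sub_padicGammaSeq_le hp2 one_ne_zero hx
  rw [padicGammaSeq_add_one_of_lt (by omega), PadicInt.norm_def] at h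
  push_cast at h
  have h2 := norm_pow_sub_pow_le (PadicInt.norm_le_one (padicGamma p (Ring.inverse 4)))
    (a' := (-1) ^ (r + 1) * (r.factorial : ℚ_[p])) ?_ h 4
  · rw [mul_pow, ← pow_mul, mul_comm (r + 1), pow_mul] at h2
    norm_num at h2 ⊢
    exact h2
  · rw [norm_mul, norm_pow, norm_neg, norm_one, one_pow, one_mul]
    simpa using Padic.norm_int_le_one (p := p) (r.factorial : ℤ)

end Supercongruence

/-! ### The supercongruence. -/

theorem theorem2 (p : ℕ) [Fact p.Prime] (hp5 : 5 ≤ p) (hp : p ≡ 3 [MOD 4]) :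
    ∃ z : ℤ_[p],
      (∑ k ∈ Finset.range ((p - 1) / 2 + 1),
          (-1 : ℚ_[p]) ^ k * (4 * (k : ℚ_[p]) + 1) *
            ((ascPochhammer ℚ_[p] k).eval (1 / 2) / (k.factorial : ℚ_[p])) ^ 5) -
        (-((p : ℚ_[p]) ^ 3 / 16) * ((padicGamma p (Ring.inverse 4) : ℤ_[p]) : ℚ_[p]) ^ 4) =
      (p : ℚ_[p]) ^ 4 * (z : ℚ_[p]) := by
  have hp2 : p ≠ 2 := by omega
  have hp1 : 1 < (p : ℝ) := by exact_mod_cast (Fact.out : p.Prime).one_lt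
  have hp0 : (p : ℝ) ≠ 0 := by positivity
  have hpK : (p : ℚ_[p]) ≠ 0 := by exact_mod_cast (Fact.out : p.Prime).ne_zero
  obtain ⟨r, hr⟩ : ∃ r, p = 4 * r + 3 := ⟨p / 4, by have : p % 4 = 3 := hp; omega⟩
  have hpr : (p : ℚ_[p]) = 4 * r + 3 := by exact_mod_cast congrArg (Nat.cast (R := ℚ_[p])) hr
  rw [show (p - 1) / 2 = 2 * r + 1 by omega]
  have hmain := norm_sum_sub_wellPoisedSum_le (p := p) (m := 2 * r + 1) (by omega)
  have hs : ∀ n : ℕ, ((n : ℚ_[p]) + 1) ^ 2 - (-((p : ℚ_[p]) ^ 2 / 4)) ≠ 0 := by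
    intro n
    -- Nonvanishing is a positivity statement over `ℚ`, carried to `ℚ_[p]` by injectivity of the
    -- cast.
    have : ((n : ℚ) + 1) ^ 2 - (-((p : ℚ) ^ 2 / 4)) ≠ 0 := by
      rw [sub_neg_eq_add]; positivity
    have h := (Rat.cast_injective (α := ℚ_[p])).ne this
    push_cast at h
    exact h
  rw [wellPoisedSum_odd hs] at hmain
  have hq : ‖-((p : ℚ_[p]) ^ 2 / 4) / 4‖ ≤ (p : ℝ) ^ (-1 : ℤ) := by
    rw [show -((p : ℚ_[p]) ^ 2 / 4) / 4 = -((p : ℚ_[p]) ^ 2 / 16) by ring, norm_neg, norm_div,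
      norm_sixteen hp2, div_one, Padic.norm_p_pow]
    exact zpow_le_zpow_right₀ hp1.le (by norm_num)
  have hX := norm_prod_ratio_sub_factorial_pow_le hr hq
  have hG := norm_padicGamma_quarter_pow_sub_le hr
  set A := ∑ k ∈ Finset.range (2 * r + 1 + 1),
          (-1 : ℚ_[p]) ^ k * (4 * (k : ℚ_[p]) + 1) *
            ((ascPochhammer ℚ_[p] k).eval (1 / 2) / (k.factorial : ℚ_[p])) ^ 5
  set Q := (∏ j ∈ Finset.range r, (((j : ℚ_[p]) + 1) ^ 2 - -((p : ℚ_[p]) ^ 2 / 4) / 4)) /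
        (∏ j ∈ Finset.range (r + 1), (((j : ℚ_[p]) + 1 / 2) ^ 2 - -((p : ℚ_[p]) ^ 2 / 4) / 4))
  set G := ((padicGamma p (Ring.inverse 4) : ℤ_[p]) : ℚ_[p])
  have hQG : ‖Q - G ^ 4‖ ≤ (p : ℝ) ^ (-1 : ℤ) := by
    rw [← sub_add_sub_cancel Q ((r.factorial : ℚ_[p]) ^ 4)]
    refine (IsUltrametricDist.norm_add_le_max _ _).trans (max_le hX ?_)
    rwa [norm_sub_rev]
  have hdiff : ‖A - -((p : ℚ_[p]) ^ 3 / 16) * G ^ 4‖ ≤ (p : ℝ) ^ (-4 : ℤ) := by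
    -- As `4 * r + 3 = p`, the closed form is `-(p³/16) * Q`, so an error divisible by `p` in `Q`
    -- costs only `p⁴`.
    have e : A - -((p : ℚ_[p]) ^ 3 / 16) * G ^ 4 =
        (A - (4 * r + 3) * (-((p : ℚ_[p]) ^ 2 / 4) / 4) * Q) +
          -((p : ℚ_[p]) ^ 3 / 16) * (Q - G ^ 4) := by
      rw [← hpr]; ring
    rw [e]
    refine (IsUltrametricDist.norm_add_le_max _ _).trans (max_le hmain ?_)
    rw [norm_mul, norm_neg, norm_div, norm_sixteen hp2, div_one, Padic.norm_p_pow,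
      show (-4 : ℤ) = -(3 : ℕ) + -1 by norm_num, zpow_add₀ hp0]
    exact mul_le_mul_of_nonneg_left hQG (zpow_nonneg (by positivity) _)
  refine ⟨⟨(A - -((p : ℚ_[p]) ^ 3 / 16) * G ^ 4) / (p : ℚ_[p]) ^ 4, ?_⟩, ?_⟩
  · rw [norm_div, Padic.norm_p_pow]
    exact div_le_one_of_le₀ hdiff (zpow_nonneg (by positivity) _)
  · exact (mul_div_cancel₀ _ (pow_ne_zero 4 hpK)).symm
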